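/- Let $X = a\,\partial_x + b\,\partial_y$, $a,b\in\mathbb C[x,y]$, be a polynomial vector field of degree $d=\max(\deg a,\deg b)$ on $\mathbb C^2$. A nonconstant $f\in\mathbb C[x,y]$ is an invariant algebraic curve of $X$ if $f$ divides $X(f)=af_x+bf_y$. For an invariant algebraic curve $f$ and $l\ge 1$, the $l$-geometric multiplicity $\mu_{g,l}(X,f)\in\mathbb N\cup\{\infty\}$ is the supremum of the integers $m\ge 0$ for which there is a sequence of vector fields $X_k$ of degree $d$ converging to $X$ such that every $X_k$ has $m$ invariant algebraic curves $f_k^{(1)},\dots,f_k^{(m)}$ of degree at most $l$, pairwise without common factors, with $f_k^{(i)}\to f$ as $k\to\infty$ for each $i$ (convergence means convergence of coefficients). Let $a_d,b_d$ be the homogeneous parts of degree $d$ of $a,b$; the line at infinity is invariant by $X$ if $xb_d-ya_d\neq 0$. Put $$ n_l(X)=\begin{cases}\dfrac{d(l^4+6l^3+11l^2+6l)-l^4-2l^3+l^2-6l}{8}, & \text{if the line at infinity is invariant},\\[2mm] \dfrac{d(l^4+6l^3+11l^2+6l)-2l^4-8l^3-10l^2-4l}{8}, & \text{otherwise}.\end{cases}$$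 Let $f_1,\dots,f_p$ be invariant algebraic curves of $X$, pairwise without common factors. If for some positive integer $l$ $$\sum_{j=1}^p \deg(f_j)\,\mu_{g,l}(X,f_j) > n_l(X),$$ or if $l\ge 2$, the line at infinity is invariant and $\sum_{j=1}^p \deg(f_j)\,\mu_{g,l}(X,f_j) \ge n_l(X)$, then $X$ admits a rational first integral, that is, a nonconstant rational function $H$ with $X(H)=0$. -/

import Mathlib

open MvPolynomial Filter Topology
open scoped ENNReal

noncomputable section

/-- A polynomial vector field `a ∂/∂x + b ∂/∂y` on `ℂ²`; the variables `x`, `y` are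
`X 0`, `X 1` in `MvPolynomial (Fin 2) ℂ`. -/
structure PlaneVectorField where
  a : MvPolynomial (Fin 2) ℂ
  b : MvPolynomial (Fin 2) ℂ

namespace PlaneVectorField

/-- The (affine) degree: the maximum of the degrees of the two components. -/
def degree (V : PlaneVectorField) : ℕ := max V.a.totalDegree V.b.totalDegree

/-- The action of the vector field on polynomials: `V(f) = a f_x + b f_y`. -/
def apply (V : PlaneVectorField) (f : MvPolynomial (Fin 2) ℂ) : MvPolynomial (Fin 2) ℂ :=
  V.a * pderiv 0 f + V.b * pderiv 1 f

/-- `f` defines an invariant algebraic curve of `V`: `f` is a nonconstant polynomial and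
`V(f) / f` is a polynomial. -/
def IsInvariantCurve (V : PlaneVectorField) (f : MvPolynomial (Fin 2) ℂ) : Prop :=
  0 < f.totalDegree ∧ f ∣ V.apply f

/-- Convergence of a sequence of polynomials, coefficient by coefficient. -/
def _root_.PolyTendsto (F : ℕ → MvPolynomial (Fin 2) ℂ) (f : MvPolynomial (Fin 2) ℂ) : Prop :=
  ∀ s : Fin 2 →₀ ℕ, Tendsto (fun k => coeff s (F k)) atTop (𝓝 (coeff s f))

/-- There is a sequence of vector fields `W k`, of the same degree as `V`, converging to `V`,
such that each `W k` has `m` invariant algebraic curves `g k 1, …, g k m` of degree at most `l`,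
pairwise without common factors, each of which converges to `f` as `k → ∞`. -/
def HasGeomMultiplicity (V : PlaneVectorField) (f : MvPolynomial (Fin 2) ℂ) (l m : ℕ) : Prop :=
  ∃ (W : ℕ → PlaneVectorField) (g : ℕ → Fin m → MvPolynomial (Fin 2) ℂ),
    (∀ k, (W k).degree = V.degree) ∧
    PolyTendsto (fun k => (W k).a) V.a ∧
    PolyTendsto (fun k => (W k).b) V.b ∧
    (∀ k i, (W k).IsInvariantCurve (g k i) ∧ (g k i).totalDegree ≤ l) ∧
    (∀ k, Pairwise fun i j => IsRelPrime (g k i) (g k j)) ∧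
    ∀ i, PolyTendsto (fun k => g k i) f

/-- The `l`-geometric multiplicity of the invariant curve `f` of `V`: the supremum of the numbers
`m` of curves occurring above. It may be infinite. -/
def geomMultiplicity (V : PlaneVectorField) (l : ℕ) (f : MvPolynomial (Fin 2) ℂ) : ℕ∞ :=
  ⨆ (m : ℕ) (_ : V.HasGeomMultiplicity f l m), (m : ℕ∞)

/-- The line at infinity is invariant by `V`: `x b_d - y a_d ≠ 0`, where `d` is the degree of `V`
and `a_d`, `b_d` are the homogeneous parts of degree `d` of the components. -/
def LineAtInfinityInvariant (V : PlaneVectorField) : Prop :=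
  X 0 * homogeneousComponent V.degree V.b - X 1 * homogeneousComponent V.degree V.a ≠ 0

open Classical in
/-- The number `n_l(V)`. -/
def nBound (V : PlaneVectorField) (l : ℕ) : ℝ :=
  if V.LineAtInfinityInvariant then
    ((V.degree : ℝ) * ((l : ℝ) ^ 4 + 6 * (l : ℝ) ^ 3 + 11 * (l : ℝ) ^ 2 + 6 * (l : ℝ))
      - (l : ℝ) ^ 4 - 2 * (l : ℝ) ^ 3 + (l : ℝ) ^ 2 - 6 * (l : ℝ)) / 8
  else
    ((V.degree : ℝ) * ((l : ℝ) ^ 4 + 6 * (l : ℝ) ^ 3 + 11 * (l : ℝ) ^ 2 + 6 * (l : ℝ))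
      - 2 * (l : ℝ) ^ 4 - 8 * (l : ℝ) ^ 3 - 10 * (l : ℝ) ^ 2 - 4 * (l : ℝ)) / 8

/-- `V` admits a rational first integral: there is a nonconstant rational function `H = P / Q`
with `V(H) = (Q V(P) - P V(Q)) / Q² = 0`. -/
def HasRationalFirstIntegral (V : PlaneVectorField) : Prop :=
  ∃ P Q : MvPolynomial (Fin 2) ℂ, Q ≠ 0 ∧ (∀ c : ℂ, P ≠ C c * Q) ∧
    Q * V.apply P - P * V.apply Q = 0

end PlaneVectorField

end

/-!
The `l`-th extactic polynomial of `V` is the Wronskian, with respect to the derivation `V`, of the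
monomials of degree at most `l`. Every invariant curve of degree at most `l` divides it, because a
linear change of the columns makes the curve itself one of them. Divisibility by a product of
polynomials passes to coefficientwise limits, so the extactic polynomial is divisible by
`f ^ m` whenever `f` has geometric multiplicity at least `m`, and
`∑ deg f_j * μ_{g,l}(V, f_j)` is at most its degree as soon as it is nonzero.

Its degree is at most `n_l(V)`: the columns of the Wronskian can be graded by the degrees of the
monomials, each row raising them by `d - 1`, and if the line at infinity is not invariant then the
part of degree `d` of `V` is a multiple `h` of the radial field, which row operations remove up to
lower order. Hence under the hypothesis of the theorem the extactic polynomial vanishes, so the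
monomials satisfy a linear relation whose coefficients are rational first integrals. They cannot
all be constant, since the monomials are independent over `ℂ`.
-/

section DegreeFiltration

variable {σ R : Type*}

/-- The polynomials of total degree at most `n`, as a submodule. The bound is an integer because it
drops below zero for iterated derivatives; for `n < 0` the submodule is trivial. -/
noncomputable def degLE (σ R : Type*) [CommSemiring R] (n : ℤ) : Submodule R (MvPolynomial σ R) :=
  restrictSupport R {s | (s.degree : ℤ) ≤ n}

section CommSemiring

variable [CommSemiring R] {m n : ℤ} {p q : MvPolynomial σ R}

lemma mem_degLE : p ∈ degLE σ R n ↔ ∀ s ∈ p.support, (s.degree : ℤ) ≤ n :=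
  mem_restrictSupport_iff R

lemma mem_degLE_natCast {k : ℕ} : p ∈ degLE σ R k ↔ p.totalDegree ≤ k := by
  simp only [mem_degLE, Nat.cast_le]
  exact Finset.sup_le_iff.symm

lemma monomial_mem_degLE {s : σ →₀ ℕ} (hs : (s.degree : ℤ) ≤ n) (r : R) :
    monomial s r ∈ degLE σ R n :=
  (monomial_mem_restrictSupport R).2 (.inl hs)

lemma degLE_mono (h : m ≤ n) : degLE σ R m ≤ degLE σ R n :=
  restrictSupport_mono R fun _ hs => le_trans hs h

lemma totalDegree_le_of_mem_degLE (hp : p ∈ degLE σ R n) (hp0 : p ≠ 0) :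
    (p.totalDegree : ℤ) ≤ n := by
  obtain ⟨s, hs⟩ := support_nonempty.2 hp0
  have hn : 0 ≤ n := (Int.natCast_nonneg _).trans (mem_degLE.1 hp s hs)
  lift n to ℕ using hn
  exact_mod_cast mem_degLE_natCast.1 hp

lemma totalDegree_le_toNat_of_mem_degLE (hp : p ∈ degLE σ R n) : p.totalDegree ≤ n.toNat :=
  mem_degLE_natCast.1 (degLE_mono (Int.self_le_toNat n) hp)

lemma mul_mem_degLE (hp : p ∈ degLE σ R m) (hq : q ∈ degLE σ R n) :
    p * q ∈ degLE σ R (m + n) := by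
  have hpq := Submodule.mul_mem_mul hp hq
  rw [degLE, degLE, ← restrictSupport_add] at hpq
  refine restrictSupport_mono R (Set.add_subset_iff.2 fun s hs t ht => ?_) hpq
  simp only [Set.mem_ofPred_eq, map_add, Nat.cast_add] at hs ht ⊢
  exact add_le_add hs ht

lemma prod_mem_degLE {ι : Type*} (s : Finset ι) {p : ι → MvPolynomial σ R} {n : ι → ℤ}
    (hp : ∀ i ∈ s, p i ∈ degLE σ R (n i)) : ∏ i ∈ s, p i ∈ degLE σ R (∑ i ∈ s, n i) := by
  classical
  induction s using Finset.induction_on with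
  | empty => simpa using monomial_mem_degLE (s := 0) (n := 0) (by simp) (1 : R)
  | insert i s hi ih =>
    rw [Finset.prod_insert hi, Finset.sum_insert hi]
    exact mul_mem_degLE (hp i (Finset.mem_insert_self i s))
      (ih fun j hj => hp j (Finset.mem_insert_of_mem hj))

lemma mem_degLE_of_X_mul_mem_degLE {i : σ} (hp : X i * p ∈ degLE σ R n) :
    p ∈ degLE σ R (n - 1) := by
  refine mem_degLE.2 fun s hs => ?_
  have hX : Finsupp.single i 1 + s ∈ (X i * p).support := by
    rwa [mem_support_iff, coeff_X_mul, ← mem_support_iff]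
  have := mem_degLE.1 hp _ hX
  rw [map_add, Finsupp.degree_single] at this
  omega

lemma pderiv_mem_degLE (hp : p ∈ degLE σ R n) (i : σ) : pderiv i p ∈ degLE σ R (n - 1) := by
  refine mem_degLE.2 fun s hs => ?_
  rw [mem_support_iff, coeff_pderiv] at hs
  have := mem_degLE.1 hp _ (mem_support_iff.2 (left_ne_zero_of_mul hs))
  rw [map_add, Finsupp.degree_single] at this
  omega

lemma homogeneousComponent_mem_degLE (k : ℕ) (p : MvPolynomial σ R) :
    homogeneousComponent k p ∈ degLE σ R k :=
  mem_degLE_natCast.2 (homogeneousComponent_isHomogeneous k p).totalDegree_le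

end CommSemiring

section CommRing

variable [CommRing R] {n : ℤ} {p : MvPolynomial σ R}

lemma det_mem_degLE {ι : Type*} [Fintype ι] [DecidableEq ι]
    {A : Matrix ι ι (MvPolynomial σ R)} {r c : ι → ℤ} (hA : ∀ i j, A i j ∈ degLE σ R (r i + c j)) :
    A.det ∈ degLE σ R (∑ i, r i + ∑ j, c j) := by
  rw [Matrix.det_apply]
  refine Submodule.sum_mem _ fun τ _ => ?_
  rw [← Equiv.sum_comp τ r, ← Finset.sum_add_distrib, Units.smul_def, zsmul_eq_mul]
  have hprod := prod_mem_degLE Finset.univ fun i _ => hA (τ i) i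
  simpa only [zsmul_eq_mul] using zsmul_mem hprod (Equiv.Perm.sign τ : ℤ)

lemma sub_homogeneousComponent_mem_degLE {k : ℕ} (hp : p ∈ degLE σ R k) :
    p - homogeneousComponent k p ∈ degLE σ R (k - 1) := by
  refine mem_degLE.2 fun s hs => ?_
  rw [mem_support_iff, coeff_sub, coeff_homogeneousComponent] at hs
  split_ifs at hs with hsk
  · exact absurd (sub_self _) hs
  · have := mem_degLE.1 hp s (mem_support_iff.2 (by rwa [sub_zero] at hs))
    omega

/-- Euler's identity makes the left-hand side vanish on monomials of degree exactly `n`. -/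
lemma euler_sub_mem_degLE [Fintype σ] (hp : p ∈ degLE σ R n) :
    ∑ i, X i * pderiv i p - n * p ∈ degLE σ R (n - 1) := by
  rw [degLE, restrictSupport_eq_span] at hp
  induction hp using Submodule.span_induction with
  | zero => simp
  | add p q _ _ hp hq =>
    convert add_mem hp hq using 1
    simp only [map_add, mul_add, Finset.sum_add_distrib]
    ring
  | smul r p _ hp =>
    convert Submodule.smul_mem _ r hp using 1
    simp only [Derivation.map_smul, mul_smul_comm, ← Finset.smul_sum, smul_sub]
  | mem p hp =>
    obtain ⟨s, hs, rfl⟩ := hp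
    rw [(isHomogeneous_monomial (1 : R) rfl).sum_X_mul_pderiv, nsmul_eq_mul]
    obtain hlt | rfl := (show (s.degree : ℤ) ≤ n from hs).lt_or_eq
    · rw [← nsmul_eq_mul, ← zsmul_eq_mul]
      have hmem : monomial s (1 : R) ∈ degLE σ R (n - 1) :=
        monomial_mem_degLE (Int.le_sub_one_of_lt hlt) 1
      exact sub_mem (nsmul_mem hmem _) (zsmul_mem hmem _)
    · simp

end CommRing

end DegreeFiltration

section Monomials

/-- The exponents of the monomials of degree at most `l`. -/
noncomputable def exponentsLE (σ : Type*) [Finite σ] (l : ℕ) : Finset (σ →₀ ℕ) :=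
  (Finsupp.finite_of_degree_le l).toFinset

/-- The monomials of degree at most `l`, enumerated in an arbitrary order by an initial segment of
`ℕ` so that they can serve as the columns of a Wronskian matrix. -/
noncomputable def monomialsLE (σ R : Type*) [Finite σ] [CommSemiring R] (l : ℕ)
    (j : Fin (exponentsLE σ l).card) : MvPolynomial σ R :=
  monomial ((exponentsLE σ l).equivFin.symm j) 1

variable {σ : Type*} [Finite σ]

lemma mem_exponentsLE {l : ℕ} {s : σ →₀ ℕ} : s ∈ exponentsLE σ l ↔ s.degree ≤ l := by
  simp [exponentsLE]

lemma linearIndependent_monomialsLE (R : Type*) [CommSemiring R] (l : ℕ) :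
    LinearIndependent R (monomialsLE σ R l) := by
  have h := (basisMonomials σ R).linearIndependent.comp _
    (Subtype.val_injective.comp (exponentsLE σ l).equivFin.symm.injective)
  rwa [coe_basisMonomials] at h

lemma mem_span_range_monomialsLE {R : Type*} [CommSemiring R] {l : ℕ} {p : MvPolynomial σ R} :
    p ∈ Submodule.span R (Set.range (monomialsLE σ R l)) ↔ p.totalDegree ≤ l := by
  have hrange : Set.range (monomialsLE σ R l) =
      (monomial · 1) '' {s : σ →₀ ℕ | (s.degree : ℤ) ≤ l} := by
    change Set.range ((monomial · (1 : R)) ∘ Subtype.val ∘ (exponentsLE σ l).equivFin.symm) = _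
    rw [Set.range_comp, EquivLike.range_comp, Subtype.range_val]
    simp only [exponentsLE, Set.Finite.coe_toFinset, Nat.cast_le]
  rw [hrange, ← restrictSupport_eq_span, ← mem_degLE_natCast, degLE]

lemma sum_exponentsLE_two {M : Type*} [AddCommMonoid M] (g : ℕ → M) (l : ℕ) :
    ∑ s ∈ exponentsLE (Fin 2) l, g s.degree = ∑ n ∈ Finset.range (l + 1), (n + 1) • g n := by
  have hmaps : ∀ s ∈ exponentsLE (Fin 2) l, s.degree ∈ Finset.range (l + 1) := fun s hs =>
    Finset.mem_range_succ_iff.2 (mem_exponentsLE.1 hs)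
  rw [← Finset.sum_fiberwise_of_maps_to hmaps]
  refine Finset.sum_congr rfl fun n hn => ?_
  have hfiber : (exponentsLE (Fin 2) l).filter (fun s => s.degree = n) =
      Finset.univ.finsuppAntidiag n := by
    ext s
    simp only [Finset.mem_filter, mem_exponentsLE, Finset.mem_finsuppAntidiag,
      Finsupp.degree_eq_sum, Finset.subset_univ, and_true, and_iff_right_iff_imp]
    exact fun h => h.trans_le (Finset.mem_range_succ_iff.1 hn)
  rw [Finset.sum_congr rfl fun s hs => by rw [(Finset.mem_filter.1 hs).2], Finset.sum_const, hfiber,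
    Finset.card_finsuppAntidiag_nat_eq_choose, Finset.card_univ, Fintype.card_fin]
  simp [show 2 + n - 1 = n + 1 by omega]

lemma two_mul_card_exponentsLE_two (l : ℕ) :
    2 * (exponentsLE (Fin 2) l).card = (l + 1) * (l + 2) := by
  rw [Finset.card_eq_sum_ones, sum_exponentsLE_two (fun _ => 1)]
  induction l with
  | zero => simp
  | succ l ih => rw [Finset.sum_range_succ, mul_add, ih, smul_eq_mul]; ring

lemma three_mul_sum_degree_exponentsLE_two (l : ℕ) :
    3 * ∑ s ∈ exponentsLE (Fin 2) l, s.degree = l * (l + 1) * (l + 2) := by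
  refine (congrArg (3 * ·) (sum_exponentsLE_two (fun n => n) l)).trans ?_
  induction l with
  | zero => simp
  | succ l ih => rw [Finset.sum_range_succ, mul_add, ih, smul_eq_mul]; ring

end Monomials

section Wronskian

open Matrix

/-- The Wronskian matrix of `v` with respect to the derivation `D`: row `i` consists of the `i`-th
iterated derivatives. -/
def wronskianMatrix {R A : Type*} [CommRing R] [CommRing A] [Algebra R A] (D : Derivation R A A)
    {n : ℕ} (v : Fin n → A) : Matrix (Fin n) (Fin n) A :=
  Matrix.of fun i j => D^[i] (v j)

/-- The Wronskian determinant of `v` with respect to the derivation `D`. -/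
def wronskianDet {R A : Type*} [CommRing R] [CommRing A] [Algebra R A] (D : Derivation R A A)
    {n : ℕ} (v : Fin n → A) : A :=
  (wronskianMatrix D v).det

section Divisibility

variable {R A : Type*} [CommRing R] [CommRing A] [Algebra R A] {D : Derivation R A A} {n : ℕ}
  {f : A}

lemma dvd_iterate_derivation (hf : f ∣ D f) (i : ℕ) : f ∣ D^[i] f := by
  induction i with
  | zero => exact dvd_rfl
  | succ i ih =>
    obtain ⟨g, hg⟩ := ih
    rw [Function.iterate_succ_apply', hg, D.leibniz, smul_eq_mul, smul_eq_mul]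
    exact dvd_add (dvd_mul_right f _) (hf.mul_left g)

lemma wronskianMatrix_mulVec_algebraMap (D : Derivation R A A) (v : Fin n → A) (r : Fin n → R) :
    wronskianMatrix D v *ᵥ (algebraMap R A ∘ r) = fun i : Fin n => D^[i] (∑ j, r j • v j) := by
  ext i
  have hiter (p : A) : D^[i] p = ((D : A →ₗ[R] A) ^ (i : ℕ)) p :=
    (Module.End.pow_apply (D : A →ₗ[R] A) i p).symm
  simp only [hiter, map_sum, map_smul, mulVec, dotProduct, wronskianMatrix, of_apply,
    Function.comp_apply]
  simp only [Algebra.smul_def, mul_comm]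

lemma dvd_smul_wronskianDet {v : Fin n → A} {r : Fin n → R} (hfr : ∑ j, r j • v j = f)
    (hf : f ∣ D f) (j : Fin n) : f ∣ r j • wronskianDet D v := by
  choose q hq using dvd_iterate_derivation hf
  have hker : wronskianMatrix D v *ᵥ (algebraMap R A ∘ r) = f • fun i : Fin n => q i := by
    rw [wronskianMatrix_mulVec_algebraMap, hfr]
    exact funext fun i => hq i
  have hdet := congrFun (congrArg ((wronskianMatrix D v).adjugate *ᵥ ·) hker) j
  simp only [mulVec_mulVec, adjugate_mul, smul_mulVec, one_mulVec, mulVec_smul, Pi.smul_apply,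
    Function.comp_apply, smul_eq_mul] at hdet
  rw [Algebra.smul_def, mul_comm, wronskianDet, hdet]
  exact dvd_mul_right f _

lemma dvd_wronskianDet {K : Type*} [Field K] [Algebra K A] {D : Derivation K A A} {v : Fin n → A}
    (hspan : f ∈ Submodule.span K (Set.range v)) (hf0 : f ≠ 0) (hf : f ∣ D f) :
    f ∣ wronskianDet D v := by
  obtain ⟨r, hr⟩ := (Submodule.mem_span_range_iff_exists_fun K).1 hspan
  obtain ⟨j, hj⟩ : ∃ j, r j ≠ 0 := by
    by_contra! hzero
    exact hf0 (by simp [← hr, hzero])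
  obtain ⟨g, hg⟩ := dvd_smul_wronskianDet hr hf j
  exact ⟨(r j)⁻¹ • g, by rw [mul_smul_comm, ← hg, inv_smul_smul₀ hj]⟩

end Divisibility

section Vanishing

variable {R A : Type*} [CommRing R] [CommRing A] [Algebra R A] {D : Derivation R A A} {n : ℕ}

lemma sum_iterate_mul_derivation_eq_zero {v c : Fin n → A} {i : ℕ}
    (hi : ∑ j, D^[i] (v j) * c j = 0) (hsucc : ∑ j, D^[i + 1] (v j) * c j = 0) :
    ∑ j, D^[i] (v j) * D (c j) = 0 := by
  have hD := congrArg D hi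
  simp only [map_sum, D.leibniz, smul_eq_mul, map_zero, Finset.sum_add_distrib,
    ← Function.iterate_succ_apply', mul_comm (c _)] at hD
  rwa [hsucc, add_zero] at hD

variable [IsDomain A]

lemma eq_zero_of_forall_sum_iterate_mul_eq_zero {v c : Fin (n + 1) → A}
    (hv : wronskianDet D (v ∘ Fin.castSucc) ≠ 0) (hlast : c (Fin.last n) = 0)
    (hc : ∀ i < n, ∑ j, D^[i] (v j) * c j = 0) : c = 0 := by
  have hinit : c ∘ Fin.castSucc = 0 := by
    refine eq_zero_of_mulVec_eq_zero hv (funext fun i => ?_)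
    have hi := hc i i.isLt
    rwa [Fin.sum_univ_castSucc, hlast, mul_zero, add_zero] at hi
  exact funext (Fin.lastCases hlast (congrFun hinit))

lemma exists_constant_relation_of_minor_ne_zero {v : Fin (n + 1) → A} (hv : wronskianDet D v = 0)
    (hminor : wronskianDet D (v ∘ Fin.castSucc) ≠ 0) :
    ∃ c : Fin (n + 1) → A, c (Fin.last n) ≠ 0 ∧
      (∀ j, c (Fin.last n) * D (c j) = c j * D (c (Fin.last n))) ∧ ∑ j, c j * v j = 0 := by
  obtain ⟨c, hc0, hc⟩ := exists_mulVec_eq_zero_iff.2 hv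
  have hrel (i : ℕ) (hi : i ≤ n) : ∑ j, D^[i] (v j) * c j = 0 :=
    congrFun hc ⟨i, Nat.lt_succ_of_le hi⟩
  refine ⟨c, fun hlast => hc0 ?_, fun j => sub_eq_zero.1 ?_, ?_⟩
  · exact eq_zero_of_forall_sum_iterate_mul_eq_zero hminor hlast fun i hi => hrel i hi.le
  -- The numerators of `D (c j / c n)` solve the first `n` equations and the last one is zero.
  · refine congrFun (eq_zero_of_forall_sum_iterate_mul_eq_zero hminor
      (c := fun j => c (Fin.last n) * D (c j) - c j * D (c (Fin.last n))) (sub_self _) ?_) j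
    intro i hi
    have hderiv := sum_iterate_mul_derivation_eq_zero (hrel i hi.le) (hrel (i + 1) hi)
    simp only [mul_sub, mul_left_comm _ (c (Fin.last n)), ← mul_assoc _ (c _) (D (c _)),
      Finset.sum_sub_distrib, ← Finset.mul_sum, ← Finset.sum_mul, hderiv, hrel i hi.le, mul_zero,
      zero_mul, sub_zero]
  · simpa only [Function.iterate_zero_apply, mul_comm (c _)] using hrel 0 n.zero_le

/-- Up to the common factor `c k`, the relation has coefficients killed by `D`: the quotients
`c j / c k` are the constants of the classical theorem. -/
theorem exists_constant_relation_of_wronskianDet_eq_zero {v : Fin n → A}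
    (hv : wronskianDet D v = 0) :
    ∃ (c : Fin n → A) (k : Fin n),
      c k ≠ 0 ∧ (∀ j, c k * D (c j) = c j * D (c k)) ∧ ∑ j, c j * v j = 0 := by
  induction n with
  | zero => simp [wronskianDet] at hv
  | succ n ih =>
    by_cases hminor : wronskianDet D (v ∘ Fin.castSucc) = 0
    · obtain ⟨c, k, hck, hconst, hrel⟩ := ih hminor
      refine ⟨Fin.snoc c 0, k.castSucc, by simpa using hck, fun j => ?_, ?_⟩
      · refine Fin.lastCases ?_ (fun j => ?_) j
        · simp
        · simpa using hconst j
      · simpa [Fin.sum_univ_castSucc] using hrel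
    · obtain ⟨c, hlast, hconst, hrel⟩ := exists_constant_relation_of_minor_ne_zero hv hminor
      exact ⟨c, Fin.last n, hlast, hconst, hrel⟩

end Vanishing

section Shift

lemma det_eq_of_sub_mem_span {R : Type*} [CommRing R] {n : ℕ} {M N : ℕ → Fin n → R}
    (h : ∀ i, M i - N i ∈ Submodule.span R (N '' Set.Iio i)) :
    (Matrix.of fun i : Fin n => M i).det = (Matrix.of fun i : Fin n => N i).det := by
  choose a ha using fun i => (Submodule.mem_span_image_finset_iff_exists_fun' R).1
    (Finset.coe_range i ▸ h i)
  let L : Matrix (Fin n) (Fin n) R := of fun i k => if k < i then a i k else 0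
  have hL : (1 + L).det = 1 := by
    rw [det_of_isLowerTriangular (1 + L) fun i k (hik : i < k) => by
      simp [L, hik.not_gt, hik.ne]]
    simp [L]
  have hM : of (fun i : Fin n => M i) = (1 + L) * of (fun i : Fin n => N i) := by
    ext i j
    have hrange : (Finset.range n).filter (· < (i : ℕ)) = Finset.range i := by
      ext k
      simp only [Finset.mem_filter, Finset.mem_range]
      omega
    have hLN : (L * of fun k : Fin n => N k) i j = M i j - N i j := by
      simp only [mul_apply, L, of_apply, ite_mul, zero_mul, Fin.lt_def]
      rw [Fin.sum_univ_eq_sum_range (fun k => if k < (i : ℕ) then a i k * N k j else 0),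
        ← Finset.sum_filter, hrange, ← Pi.sub_apply, ← ha i, Finset.sum_apply]
      rfl
    rw [add_mul, one_mul, Matrix.add_apply, hLN, of_apply, of_apply, add_sub_cancel]
  rw [hM, det_mul, hL, one_mul]

variable {R A : Type*} [CommRing R] [CommRing A] [Algebra R A]

/-- The composition `(D - t (i - 1)) ∘ ⋯ ∘ (D - t 0)`, replacing `D^[i]` as a row operation on
Wronskian matrices. -/
def shiftedIterate (D : Derivation R A A) (t : ℕ → A) : ℕ → A → A
  | 0, p => p
  | i + 1, p => D (shiftedIterate D t i p) - t i * shiftedIterate D t i p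

lemma derivation_comp_mem_span {ι : Type*} (D : Derivation R A A) (v : ι → A) {i : ℕ} {w : ι → A}
    (hw : w ∈ Submodule.span A ((fun k j => D^[k] (v j)) '' Set.Iio i)) :
    (fun j => D (w j)) ∈ Submodule.span A ((fun k j => D^[k] (v j)) '' Set.Iio (i + 1)) := by
  induction hw using Submodule.span_induction with
  | zero =>
    convert Submodule.zero_mem _
    exact map_zero D
  | add w₁ w₂ _ _ h₁ h₂ =>
    convert add_mem h₁ h₂ using 1
    exact funext fun j => map_add D (w₁ j) (w₂ j)
  | smul a w hw h =>
    have hle : Submodule.span A ((fun k j => D^[k] (v j)) '' Set.Iio i) ≤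
        Submodule.span A ((fun k j => D^[k] (v j)) '' Set.Iio (i + 1)) :=
      Submodule.span_mono (Set.image_mono (Set.Iio_subset_Iio i.le_succ))
    convert add_mem (Submodule.smul_mem _ a h) (Submodule.smul_mem _ (D a) (hle hw)) using 1
    ext j
    simp [mul_comm]
  | mem w hw =>
    obtain ⟨k, hk, rfl⟩ := hw
    refine Submodule.subset_span ⟨k + 1, Nat.succ_lt_succ hk, ?_⟩
    ext j
    exact Function.iterate_succ_apply' D k (v j)

lemma det_shiftedIterate_eq_wronskianDet (D : Derivation R A A) (t : ℕ → A) {n : ℕ}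
    (v : Fin n → A) :
    (Matrix.of fun i j : Fin n => shiftedIterate D t i (v j)).det = wronskianDet D v := by
  refine det_eq_of_sub_mem_span (M := fun i j => shiftedIterate D t i (v j))
    (N := fun i j => D^[i] (v j)) fun i => ?_
  induction i with
  | zero => simp [shiftedIterate]
  | succ i ih =>
    set N : ℕ → Fin n → A := fun k j => D^[k] (v j)
    have hle : Submodule.span A (N '' Set.Iio i) ≤ Submodule.span A (N '' Set.Iio (i + 1)) :=
      Submodule.span_mono (Set.image_mono (Set.Iio_subset_Iio i.le_succ))
    have hN : N i ∈ Submodule.span A (N '' Set.Iio (i + 1)) :=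
      Submodule.subset_span ⟨i, Nat.lt_succ_self i, rfl⟩
    have hshift : (fun j => shiftedIterate D t i (v j)) ∈ Submodule.span A (N '' Set.Iio (i + 1)) :=
      (Submodule.sub_mem_iff_left _ hN).1 (hle ih)
    convert sub_mem (derivation_comp_mem_span D v ih) (Submodule.smul_mem _ (t i) hshift) using 1
    ext j
    simp only [shiftedIterate, Pi.sub_apply, Pi.smul_apply, smul_eq_mul, map_sub,
      Function.iterate_succ_apply']
    ring

end Shift

section Degree

variable {σ R : Type*} [CommRing R] {D : Derivation R (MvPolynomial σ R) (MvPolynomial σ R)}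
  {e : ℤ} {n : ℕ} {v : Fin n → MvPolynomial σ R}

lemma sum_fin_mul_eq_choose_two_mul (n : ℕ) (e : ℤ) :
    ∑ i : Fin n, (i : ℤ) * e = n.choose 2 * e := by
  rw [← Finset.sum_mul, Fin.sum_univ_eq_sum_range (fun i => (i : ℤ)) n, ← Nat.cast_sum,
    Finset.sum_range_id, Nat.choose_two_right]

lemma wronskianDet_mem_degLE
    (hD : ∀ {m : ℤ} {p : MvPolynomial σ R}, p ∈ degLE σ R m → D p ∈ degLE σ R (m + e))
    {c : Fin n → ℤ} (hv : ∀ j, v j ∈ degLE σ R (c j)) :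
    wronskianDet D v ∈ degLE σ R (n.choose 2 * e + ∑ j, c j) := by
  have hiter (i : ℕ) (j : Fin n) : D^[i] (v j) ∈ degLE σ R (i * e + c j) := by
    induction i with
    | zero => simpa using hv j
    | succ i ih =>
      rw [Function.iterate_succ_apply']
      exact (by push_cast; ring : (i * e + c j) + e = (i + 1 : ℕ) * e + c j) ▸ hD ih
  rw [← sum_fin_mul_eq_choose_two_mul]
  exact det_mem_degLE fun i j => hiter i j

/-- Subtracting `(l + i * e) * h` from `D` at step `i` is a row operation, and it cancels the part
of `D` that raises the degree by more than `e`. -/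
lemma wronskianDet_mem_degLE_of_sub_mem {h : MvPolynomial σ R} {l : ℤ}
    (hD : ∀ {m : ℤ} {p : MvPolynomial σ R},
      p ∈ degLE σ R m → D p - m * h * p ∈ degLE σ R (m + e))
    (hv : ∀ j, v j ∈ degLE σ R l) :
    wronskianDet D v ∈ degLE σ R (n.choose 2 * e + n * l) := by
  let t (i : ℕ) : MvPolynomial σ R := ((i * e + l : ℤ) : MvPolynomial σ R) * h
  have hiter (i : ℕ) (j : Fin n) : shiftedIterate D t i (v j) ∈ degLE σ R (i * e + l) := by
    induction i with
    | zero => simpa [shiftedIterate] using hv j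
    | succ i ih => exact (by push_cast; ring : (i * e + l) + e = (i + 1 : ℕ) * e + l) ▸ hD ih
  rw [← sum_fin_mul_eq_choose_two_mul, ← det_shiftedIterate_eq_wronskianDet D t]
  simpa using det_mem_degLE (A := Matrix.of fun i j : Fin n => shiftedIterate D t i (v j))
    (c := fun _ => l) fun i j => hiter i j

end Degree

end Wronskian

namespace PlaneVectorField

/-- The action of the vector field on polynomials as a derivation. -/
noncomputable def toDerivation (V : PlaneVectorField) :
    Derivation ℂ (MvPolynomial (Fin 2) ℂ) (MvPolynomial (Fin 2) ℂ) :=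
  V.a • pderiv 0 + V.b • pderiv 1

/-- The `l`-th extactic polynomial: the Wronskian of the monomials of degree at most `l` along `V`.
Its zero set contains every invariant curve of degree at most `l`. -/
noncomputable def extactic (V : PlaneVectorField) (l : ℕ) : MvPolynomial (Fin 2) ℂ :=
  wronskianDet V.toDerivation (monomialsLE (Fin 2) ℂ l)

variable {V : PlaneVectorField} {f : MvPolynomial (Fin 2) ℂ} {l : ℕ}

lemma IsInvariantCurve.ne_zero (hf : V.IsInvariantCurve f) : f ≠ 0 := by
  rintro rfl
  simpa using hf.1

lemma IsInvariantCurve.dvd_extactic (hf : V.IsInvariantCurve f) (hl : f.totalDegree ≤ l) :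
    f ∣ V.extactic l :=
  dvd_wronskianDet (mem_span_range_monomialsLE.2 hl) hf.ne_zero hf.2

lemma hasRationalFirstIntegral_of_wronskianDet_eq_zero {n : ℕ}
    {v : Fin n → MvPolynomial (Fin 2) ℂ} (hv : LinearIndependent ℂ v)
    (hW : wronskianDet V.toDerivation v = 0) : V.HasRationalFirstIntegral := by
  obtain ⟨c, k, hck, hconst, hrel⟩ := exists_constant_relation_of_wronskianDet_eq_zero hW
  by_contra hV
  have hscalar (j : Fin n) : ∃ r : ℂ, c j = C r * c k := by
    by_contra! hj
    exact hV ⟨c j, c k, hck, hj, sub_eq_zero.2 (hconst j)⟩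
  choose r hr using hscalar
  have hsum : ∑ j, r j • v j = 0 := by
    refine (mul_eq_zero_iff_left hck).1 (Eq.trans ?_ hrel)
    rw [Finset.mul_sum]
    refine Finset.sum_congr rfl fun j _ => ?_
    rw [hr j, smul_eq_C_mul]
    ring
  refine hck ?_
  rw [hr k, Fintype.linearIndependent_iff.1 hv r hsum k, C_0, zero_mul]

lemma toDerivation_mem_degLE {m : ℤ} {p : MvPolynomial (Fin 2) ℂ} (hp : p ∈ degLE (Fin 2) ℂ m) :
    V.toDerivation p ∈ degLE (Fin 2) ℂ (m + (V.degree - 1)) := by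
  have ha : V.a ∈ degLE (Fin 2) ℂ V.degree := mem_degLE_natCast.2 (le_max_left _ _)
  have hb : V.b ∈ degLE (Fin 2) ℂ V.degree := mem_degLE_natCast.2 (le_max_right _ _)
  rw [show m + (V.degree - 1 : ℤ) = V.degree + (m - 1) by ring]
  exact add_mem (mul_mem_degLE ha (pderiv_mem_degLE hp 0))
    (mul_mem_degLE hb (pderiv_mem_degLE hp 1))

lemma extactic_mem_degLE (V : PlaneVectorField) (l : ℕ) :
    V.extactic l ∈ degLE (Fin 2) ℂ ((exponentsLE (Fin 2) l).card.choose 2 * (V.degree - 1) +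
      (∑ s ∈ exponentsLE (Fin 2) l, s.degree : ℕ)) := by
  have hsum : ((∑ s ∈ exponentsLE (Fin 2) l, s.degree : ℕ) : ℤ) =
      ∑ j, (((exponentsLE (Fin 2) l).equivFin.symm j : Fin 2 →₀ ℕ).degree : ℤ) := by
    rw [Equiv.sum_comp (exponentsLE (Fin 2) l).equivFin.symm fun s =>
        (s.val.degree : ℤ),
      Finset.sum_coe_sort _ fun s : Fin 2 →₀ ℕ => (s.degree : ℤ), Nat.cast_sum]
  rw [hsum]
  exact wronskianDet_mem_degLE toDerivation_mem_degLE fun j => monomial_mem_degLE le_rfl 1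

lemma exists_radial_part (hV : ¬ V.LineAtInfinityInvariant) :
    ∃ h ∈ degLE (Fin 2) ℂ (V.degree - 1),
      V.a - X 0 * h ∈ degLE (Fin 2) ℂ (V.degree - 1) ∧
        V.b - X 1 * h ∈ degLE (Fin 2) ℂ (V.degree - 1) := by
  have htop : X 0 * homogeneousComponent V.degree V.b = X 1 * homogeneousComponent V.degree V.a :=
    sub_eq_zero.1 (not_not.1 hV)
  obtain ⟨h, ha⟩ : X 0 ∣ homogeneousComponent V.degree V.a :=
    ((X_prime (i := (0 : Fin 2))).dvd_or_dvd (Dvd.intro _ htop)).resolve_left (by simp [X_dvd_X])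
  have hb : homogeneousComponent V.degree V.b = X 1 * h :=
    mul_left_cancel₀ (X_ne_zero 0) (by rw [htop, ha]; ring)
  refine ⟨h, mem_degLE_of_X_mul_mem_degLE (ha ▸ homogeneousComponent_mem_degLE _ _), ?_, ?_⟩
  · exact ha ▸ sub_homogeneousComponent_mem_degLE (mem_degLE_natCast.2 (le_max_left _ _))
  · exact hb ▸ sub_homogeneousComponent_mem_degLE (mem_degLE_natCast.2 (le_max_right _ _))

lemma extactic_mem_degLE_of_not_lineAtInfinityInvariant (hV : ¬ V.LineAtInfinityInvariant)
    (l : ℕ) :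
    V.extactic l ∈ degLE (Fin 2) ℂ ((exponentsLE (Fin 2) l).card.choose 2 * (V.degree - 2) +
      (exponentsLE (Fin 2) l).card * l) := by
  obtain ⟨h, hh, ha, hb⟩ := exists_radial_part hV
  refine wronskianDet_mem_degLE_of_sub_mem (h := h) (fun {m p} hp => ?_) fun j =>
    monomial_mem_degLE (Nat.cast_le.2 (mem_exponentsLE.1 (Subtype.prop _))) 1
  have hsplit : V.toDerivation p - (m : MvPolynomial (Fin 2) ℂ) * h * p =
      (V.a - X 0 * h) * pderiv 0 p + (V.b - X 1 * h) * pderiv 1 p +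
        h * (∑ i, X i * pderiv i p - (m : MvPolynomial (Fin 2) ℂ) * p) := by
    rw [Fin.sum_univ_two]
    change V.a * pderiv 0 p + V.b * pderiv 1 p - _ = _
    ring
  rw [hsplit, show m + (V.degree - 2 : ℤ) = (V.degree - 1) + (m - 1) by ring]
  exact add_mem (add_mem (mul_mem_degLE ha (pderiv_mem_degLE hp 0))
    (mul_mem_degLE hb (pderiv_mem_degLE hp 1))) (mul_mem_degLE hh (euler_sub_mem_degLE hp))

end PlaneVectorField

section CoefficientwiseLimits

variable {σ ι α K : Type*} [NontriviallyNormedField K] [CompleteSpace K] {L : Filter α}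

lemma eventually_linearIndependent_of_tendsto_coeff [Finite ι] {F : α → ι → MvPolynomial σ K}
    {f : ι → MvPolynomial σ K} (hf : LinearIndependent K f)
    (hF : ∀ i s, Tendsto (fun k => coeff s (F k i)) L (𝓝 (coeff s (f i)))) :
    ∀ᶠ k in L, LinearIndependent K (F k) := by
  classical
  cases nonempty_fintype ι
  let T : Finset (σ →₀ ℕ) := Finset.univ.biUnion fun i => (f i).support
  let coeffs : MvPolynomial σ K →ₗ[K] (T → K) := LinearMap.pi fun s => lcoeff K s
  have hspan : Submodule.span K (Set.range f) ≤ restrictSupport K T :=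
    Submodule.span_le.2 <| Set.range_subset_iff.2 fun i => (mem_restrictSupport_iff K).2 <|
      Finset.coe_subset.2 (Finset.subset_biUnion_of_mem (fun i => (f i).support)
        (Finset.mem_univ i))
  have hker : Disjoint (Submodule.span K (Set.range f)) (LinearMap.ker coeffs) := by
    refine Submodule.disjoint_def.2 fun p hp hp0 => ?_
    ext s
    by_contra hs
    have hsT : s ∈ T := (mem_restrictSupport_iff K).1 (hspan hp) (mem_support_iff.2 hs)
    exact hs (congrFun (LinearMap.mem_ker.1 hp0) ⟨s, hsT⟩)
  have hlim : Tendsto (fun k => coeffs ∘ F k) L (𝓝 (coeffs ∘ f)) :=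
    tendsto_pi_nhds.2 fun i => tendsto_pi_nhds.2 fun s => hF i s
  exact (hlim.eventually (hf.map hker).eventually).mono fun k hk => hk.of_comp coeffs

/-- If `f` did not divide `h`, then `h` would be independent of the products of `f` with the
monomials of degree at most `N`, and this would persist along the sequence. -/
theorem dvd_of_tendsto_coeff [Finite σ] [L.NeBot] {F H : α → MvPolynomial σ K}
    {f h : MvPolynomial σ K} {N : ℕ} (hf0 : f ≠ 0)
    (hF : ∀ s, Tendsto (fun k => coeff s (F k)) L (𝓝 (coeff s f)))
    (hH : ∀ s, Tendsto (fun k => coeff s (H k)) L (𝓝 (coeff s h)))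
    (hdvd : ∀ k, F k ∣ H k) (hdeg : ∀ k, (H k).totalDegree ≤ N) : f ∣ h := by
  by_contra hndvd
  let multiples (p : MvPolynomial σ K) := LinearMap.mulLeft K p ∘ monomialsLE σ K N
  have hspan (p) : Submodule.span K (Set.range (multiples p)) =
      (Submodule.span K (Set.range (monomialsLE σ K N))).map (LinearMap.mulLeft K p) := by
    rw [Set.range_comp, Submodule.map_span]
  have hmult : LinearIndependent K (multiples f) :=
    (linearIndependent_monomialsLE K N).map' _ (LinearMap.ker_eq_bot.2 (mul_right_injective₀ hf0))
  have hh : h ∉ Submodule.span K (Set.range (multiples f)) := by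
    rw [hspan]
    rintro ⟨q, -, rfl⟩
    exact hndvd (dvd_mul_right f q)
  have hlim : ∀ i s, Tendsto (fun k => coeff s (Option.casesOn' i (H k) (multiples (F k)))) L
      (𝓝 (coeff s (Option.casesOn' i h (multiples f)))) := by
    rintro (_ | j) s
    · exact hH s
    · simp only [multiples, monomialsLE, Option.casesOn'_some, Function.comp_apply,
        LinearMap.mulLeft_apply, coeff_mul_monomial', mul_one]
      split_ifs
      exacts [hF _, tendsto_const_nhds]
  obtain ⟨k, hk⟩ := (eventually_linearIndependent_of_tendsto_coeff
    (linearIndependent_option'.2 ⟨hmult, hh⟩) hlim).exists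
  refine (linearIndependent_option'.1 hk).2 ?_
  obtain ⟨q, hq⟩ := hdvd k
  obtain hk0 | hk0 := eq_or_ne (H k) 0
  · rw [hk0]
    exact zero_mem _
  · rw [hspan, hq]
    refine Submodule.mem_map_of_mem (mem_span_range_monomialsLE.2 ((hdeg k).trans' ?_))
    exact totalDegree_le_of_dvd_of_isDomain (Dvd.intro_left _ hq.symm) hk0

end CoefficientwiseLimits

section PolyTendsto

open scoped MvPowerSeries.WithPiTopology

variable {F G : ℕ → MvPolynomial (Fin 2) ℂ} {f g : MvPolynomial (Fin 2) ℂ}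

lemma polyTendsto_iff_tendsto_toMvPowerSeries :
    PolyTendsto F f ↔
      Tendsto (fun k => coeToMvPowerSeries.ringHom (F k)) atTop
        (𝓝 (coeToMvPowerSeries.ringHom f)) := by
  simp only [MvPowerSeries.WithPiTopology.tendsto_iff_coeff_tendsto,
    coeToMvPowerSeries.ringHom_apply, coeff_coe, PolyTendsto]

namespace PolyTendsto

lemma const (f : MvPolynomial (Fin 2) ℂ) : PolyTendsto (fun _ => f) f :=
  fun _ => tendsto_const_nhds

lemma add (hF : PolyTendsto F f) (hG : PolyTendsto G g) :
    PolyTendsto (fun k => F k + G k) (f + g) := fun s => by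
  simpa only [coeff_add] using (hF s).add (hG s)

lemma mul (hF : PolyTendsto F f) (hG : PolyTendsto G g) :
    PolyTendsto (fun k => F k * G k) (f * g) := by
  rw [polyTendsto_iff_tendsto_toMvPowerSeries] at *
  simpa only [map_mul] using hF.mul hG

lemma finsetProd {ι : Type*} (s : Finset ι) {F : ℕ → ι → MvPolynomial (Fin 2) ℂ}
    {f : ι → MvPolynomial (Fin 2) ℂ} (hF : ∀ i ∈ s, PolyTendsto (F · i) (f i)) :
    PolyTendsto (fun k => ∏ i ∈ s, F k i) (∏ i ∈ s, f i) := by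
  simp only [polyTendsto_iff_tendsto_toMvPowerSeries, map_prod] at hF ⊢
  exact tendsto_finsetProd s hF

lemma det {ι : Type*} [Fintype ι] [DecidableEq ι]
    {F : ℕ → Matrix ι ι (MvPolynomial (Fin 2) ℂ)} {f : Matrix ι ι (MvPolynomial (Fin 2) ℂ)}
    (hF : ∀ i j, PolyTendsto (F · i j) (f i j)) : PolyTendsto (fun k => (F k).det) f.det := by
  simp only [polyTendsto_iff_tendsto_toMvPowerSeries, RingHom.map_det] at hF ⊢
  exact (continuous_id.matrix_det.tendsto _).comp
    (tendsto_pi_nhds.2 fun i => tendsto_pi_nhds.2 fun j => hF i j)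

lemma pderiv (hF : PolyTendsto F f) (i : Fin 2) :
    PolyTendsto (fun k => MvPolynomial.pderiv i (F k)) (MvPolynomial.pderiv i f) := fun s => by
  simpa only [coeff_pderiv] using (hF _).mul_const _

end PolyTendsto

end PolyTendsto

section DegreeCount

variable {σ R : Type*} [CommRing R] [IsDomain R]

lemma totalDegree_pow_of_isDomain (p : MvPolynomial σ R) (n : ℕ) :
    (p ^ n).totalDegree = n * p.totalDegree := by
  obtain rfl | hp := eq_or_ne p 0
  · simp [zero_pow_eq, apply_ite totalDegree]
  · induction n with
    | zero => simp
    | succ n ih => rw [pow_succ, totalDegree_mul_of_isDomain (pow_ne_zero n hp) hp, ih, add_one_mul]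

lemma totalDegree_prod_of_isDomain {ι : Type*} (s : Finset ι) {p : ι → MvPolynomial σ R}
    (hp : ∀ i ∈ s, p i ≠ 0) : (∏ i ∈ s, p i).totalDegree = ∑ i ∈ s, (p i).totalDegree := by
  classical
  induction s using Finset.induction_on with
  | empty => simp
  | insert i s hi ih =>
    have hs : ∀ j ∈ s, p j ≠ 0 := fun j hj => hp j (Finset.mem_insert_of_mem hj)
    rw [Finset.prod_insert hi, Finset.sum_insert hi, totalDegree_mul_of_isDomain
      (hp i (Finset.mem_insert_self i s)) (Finset.prod_ne_zero_iff.2 hs), ih hs]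

lemma finiteMultiplicity_of_totalDegree_pos {p q : MvPolynomial σ R} (hp : 0 < p.totalDegree)
    (hq : q ≠ 0) : FiniteMultiplicity p q := by
  refine ⟨q.totalDegree, fun hdvd => ?_⟩
  have hle := totalDegree_le_of_dvd_of_isDomain hdvd hq
  rw [totalDegree_pow_of_isDomain] at hle
  nlinarith

theorem sum_totalDegree_mul_emultiplicity_le [UniqueFactorizationMonoid R] {ι : Type*} [Fintype ι]
    {p : ι → MvPolynomial σ R} {q : MvPolynomial σ R} (hq : q ≠ 0)
    (hp : Pairwise fun i j => IsRelPrime (p i) (p j)) :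
    ∑ i, ((p i).totalDegree : ℕ∞) * emultiplicity (p i) q ≤ q.totalDegree := by
  have hdvd : ∏ i, p i ^ multiplicity (p i) q ∣ q :=
    Finset.prod_dvd_of_isRelPrime (fun i _ j _ hij => (hp hij).pow) fun i _ =>
      pow_multiplicity_dvd (p i) q
  have hne : ∀ i ∈ Finset.univ, p i ^ multiplicity (p i) q ≠ 0 :=
    Finset.prod_ne_zero_iff.1 (ne_zero_of_dvd_ne_zero hq hdvd)
  have hterm (i : ι) : ((p i).totalDegree : ℕ∞) * emultiplicity (p i) q =
      (p i ^ multiplicity (p i) q).totalDegree := by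
    rw [totalDegree_pow_of_isDomain, Nat.cast_mul, mul_comm]
    obtain h0 | hpos := (p i).totalDegree.eq_zero_or_pos
    · simp [h0]
    · rw [(finiteMultiplicity_of_totalDegree_pos hpos hq).emultiplicity_eq_multiplicity]
  simp only [hterm, ← Nat.cast_sum, ← totalDegree_prod_of_isDomain _ hne, Nat.cast_le]
  exact totalDegree_le_of_dvd_of_isDomain hdvd hq

end DegreeCount

namespace PlaneVectorField

section Limits

variable {V : PlaneVectorField} {W : ℕ → PlaneVectorField} {f : MvPolynomial (Fin 2) ℂ} {l m : ℕ}

lemma polyTendsto_apply (ha : PolyTendsto (fun k => (W k).a) V.a)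
    (hb : PolyTendsto (fun k => (W k).b) V.b) {F : ℕ → MvPolynomial (Fin 2) ℂ}
    (hF : PolyTendsto F f) : PolyTendsto (fun k => (W k).apply (F k)) (V.apply f) :=
  (ha.mul (hF.pderiv 0)).add (hb.mul (hF.pderiv 1))

lemma polyTendsto_extactic (ha : PolyTendsto (fun k => (W k).a) V.a)
    (hb : PolyTendsto (fun k => (W k).b) V.b) (l : ℕ) :
    PolyTendsto (fun k => (W k).extactic l) (V.extactic l) := by
  have hiter (i : ℕ) (p : MvPolynomial (Fin 2) ℂ) :
      PolyTendsto (fun k => (W k).toDerivation^[i] p) (V.toDerivation^[i] p) := by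
    induction i with
    | zero => exact .const p
    | succ i ih =>
      simp only [Function.iterate_succ_apply']
      exact polyTendsto_apply ha hb ih
  exact PolyTendsto.det fun i j => hiter i _

lemma HasGeomMultiplicity.pow_dvd_extactic (hf0 : f ≠ 0) (hm : V.HasGeomMultiplicity f l m) :
    f ^ m ∣ V.extactic l := by
  obtain ⟨W, g, hdeg, ha, hb, hinv, hcop, hg⟩ := hm
  have hpow : PolyTendsto (fun k => ∏ i, g k i) (f ^ m) := by
    simpa using PolyTendsto.finsetProd Finset.univ fun i _ => hg i
  refine dvd_of_tendsto_coeff (pow_ne_zero m hf0) hpow (polyTendsto_extactic ha hb l)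
    (fun k => ?_) fun k => totalDegree_le_toNat_of_mem_degLE (hdeg k ▸ (W k).extactic_mem_degLE l)
  exact Finset.prod_dvd_of_isRelPrime (fun i _ j _ hij => hcop k hij) fun i _ =>
    (hinv k i).1.dvd_extactic (hinv k i).2

lemma geomMultiplicity_le_emultiplicity_extactic (hf0 : f ≠ 0) (l : ℕ) :
    V.geomMultiplicity l f ≤ emultiplicity f (V.extactic l) :=
  iSup₂_le fun _ hm => le_emultiplicity_of_pow_dvd (hm.pow_dvd_extactic hf0)

end Limits

section Bound

variable {V : PlaneVectorField} {l : ℕ}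

lemma cast_choose_two_card_exponentsLE_two (l : ℕ) :
    ((exponentsLE (Fin 2) l).card.choose 2 : ℝ) = l * (l + 1) * (l + 2) * (l + 3) / 8 := by
  have hcard : (2 * (exponentsLE (Fin 2) l).card : ℝ) = (l + 1) * (l + 2) :=
    mod_cast two_mul_card_exponentsLE_two l
  rw [Nat.cast_choose_two, (eq_div_of_mul_eq two_ne_zero ((mul_comm _ _).trans hcard) :
    ((exponentsLE (Fin 2) l).card : ℝ) = _)]
  ring

lemma totalDegree_extactic_add_le_nBound (hV : V.LineAtInfinityInvariant)
    (hE : V.extactic l ≠ 0) :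
    (V.extactic l).totalDegree + (l * (l - 1) * (l + 4) / 6 : ℝ) ≤ V.nBound l := by
  have hdeg : ((V.extactic l).totalDegree : ℝ) ≤
      (exponentsLE (Fin 2) l).card.choose 2 * (V.degree - 1) +
        (∑ s ∈ exponentsLE (Fin 2) l, s.degree : ℕ) :=
    mod_cast totalDegree_le_of_mem_degLE (V.extactic_mem_degLE l) hE
  have hsum : (3 * (∑ s ∈ exponentsLE (Fin 2) l, s.degree : ℕ) : ℝ) = l * (l + 1) * (l + 2) :=
    mod_cast three_mul_sum_degree_exponentsLE_two l
  rw [cast_choose_two_card_exponentsLE_two] at hdeg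
  rw [nBound, if_pos hV]
  linarith

lemma totalDegree_extactic_lt_nBound (hl : 2 ≤ l) (hV : V.LineAtInfinityInvariant)
    (hE : V.extactic l ≠ 0) : (V.extactic l).totalDegree < V.nBound l := by
  have hl' : (2 : ℝ) ≤ l := mod_cast hl
  have hgap : (0 : ℝ) < l * (l - 1) * (l + 4) / 6 := by
    have : (0 : ℝ) < l - 1 := by linarith
    positivity
  exact (lt_add_of_pos_right _ hgap).trans_le (totalDegree_extactic_add_le_nBound hV hE)

lemma totalDegree_extactic_le_nBound (hE : V.extactic l ≠ 0) :
    (V.extactic l).totalDegree ≤ V.nBound l := by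
  by_cases hV : V.LineAtInfinityInvariant
  · have hgap : (0 : ℝ) ≤ l * (l - 1) * (l + 4) / 6 := by
      obtain rfl | hl := l.eq_zero_or_pos
      · simp
      · have : (0 : ℝ) ≤ l - 1 := sub_nonneg.2 (mod_cast hl)
        positivity
    exact (le_add_of_nonneg_right hgap).trans (totalDegree_extactic_add_le_nBound hV hE)
  · have hdeg : ((V.extactic l).totalDegree : ℝ) ≤
        (exponentsLE (Fin 2) l).card.choose 2 * (V.degree - 2) +
          (exponentsLE (Fin 2) l).card * l :=
      mod_cast totalDegree_le_of_mem_degLE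
        (extactic_mem_degLE_of_not_lineAtInfinityInvariant hV l) hE
    have hcard : (2 * (exponentsLE (Fin 2) l).card : ℝ) = (l + 1) * (l + 2) :=
      mod_cast two_mul_card_exponentsLE_two l
    rw [cast_choose_two_card_exponentsLE_two] at hdeg
    rw [nBound, if_neg hV]
    linear_combination hdeg + (l : ℝ) / 2 * hcard

end Bound

end PlaneVectorField

theorem mainTheorem2 (V : PlaneVectorField) (p : ℕ) (f : Fin p → MvPolynomial (Fin 2) ℂ)
    (hf : ∀ j, V.IsInvariantCurve (f j))
    (hdist : Pairwise fun i j => IsRelPrime (f i) (f j))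
    (l : ℕ) (hl : 0 < l)
    (hsum :
      ((V.nBound l : ℝ) : EReal) <
          (((∑ j, ((f j).totalDegree : ℕ∞) * V.geomMultiplicity l (f j) : ℕ∞) : ℝ≥0∞) : EReal) ∨
        (2 ≤ l ∧ V.LineAtInfinityInvariant ∧
          ((V.nBound l : ℝ) : EReal) ≤
            (((∑ j, ((f j).totalDegree : ℕ∞) * V.geomMultiplicity l (f j) : ℕ∞) : ℝ≥0∞)
              : EReal))) :
    V.HasRationalFirstIntegral := by
  by_contra hV
  have hE : V.extactic l ≠ 0 := fun h =>
    hV (PlaneVectorField.hasRationalFirstIntegral_of_wronskianDet_eq_zero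
      (linearIndependent_monomialsLE ℂ l) h)
  have hcount : ∑ j, ((f j).totalDegree : ℕ∞) * V.geomMultiplicity l (f j) ≤
      (V.extactic l).totalDegree :=
    (Finset.sum_le_sum fun j _ => mul_le_mul_right
      (PlaneVectorField.geomMultiplicity_le_emultiplicity_extactic (hf j).ne_zero l) _).trans
      (sum_totalDegree_mul_emultiplicity_le hE hdist)
  have hcast : (((∑ j, ((f j).totalDegree : ℕ∞) * V.geomMultiplicity l (f j) : ℕ∞) : ℝ≥0∞) :
      EReal) ≤ ((V.extactic l).totalDegree : ℝ) :=
    (EReal.coe_ennreal_le_coe_ennreal_iff.2 (ENat.toENNReal_le.2 hcount)).trans_eq rfl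
  obtain hlt | ⟨hl2, hinv, hle⟩ := hsum
  · exact (PlaneVectorField.totalDegree_extactic_le_nBound hE).not_gt
      (EReal.coe_lt_coe_iff.1 (hlt.trans_le hcast))
  · exact (PlaneVectorField.totalDegree_extactic_lt_nBound hl2 hinv hE).not_ge
      (EReal.coe_le_coe_iff.1 (hle.trans hcast))
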